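/- All graphs are finite and simple. A (proper) coloring $c$ of a graph $G$ assigns colors to the vertices so that adjacent vertices get different colors; it is acyclic if the vertices of any two colors induce a forest. A recoloring step chooses a color $i$ of $c$ and gives to every vertex $v$ with $c(v)=i$ some color used by $c$ that occurs neither at $v$ nor at a neighbor of $v$ under $c$, leaving all other vertices unchanged; it is acyclic if $c$ and the new coloring are both acyclic. The b-chromatic number $\varphi(G)$ is the maximum number of colors of a minimal element of the strict partial order on all colorings of $G$ that is the transitive closure of the recoloring steps. The acyclic b-chromatic number $A_b(G)$ is the maximum number of colors of a minimal element of the strict partial order on all acyclic colorings of $G$ that is the transitive closure of the acyclic recoloring steps. $\Delta(G)$ is the maximum degree. **Theorem.** There is an infinite family of graphs $G_1,G_2,\dots$ such that for every $n\ge 1$ $$A_b(G_n)=2n+4,\qquad \Delta(G_n)=n+3 ,$$ and hence $A_b(G_n)>\Delta(G_n)+1$ for every $n\ge 1$ and $A_b(G_n)-\Delta(G_n)\to\infty$ as $n\to\infty$. In contrast, $\varphi(G)\le\Delta(G)+1$ for every graph $G$. -/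

import Mathlib

namespace AcyclicBColoring

variable {V : Type*} {G : SimpleGraph V}

/-- The number of colors `|c|` that a proper coloring `c` uses. Colorings take values in `ℕ`;
the set of colors of `c` (the set `[k]` of a `k`-coloring, up to renaming) is `Set.range c`. -/
noncomputable def numColors (c : G.Coloring ℕ) : ℕ := (Set.range c).ncard

/-- The set `CN_c[v]` of the colors that occur in the closed neighborhood of `v`. -/
def closedNeighborColors (c : G.Coloring ℕ) (v : V) : Set ℕ :=
  {a | ∃ w, (w = v ∨ G.Adj v w) ∧ c w = a}

/-- `c'` arises from `c` by a recoloring step: one color `i` of `c` is eliminated by giving to each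
vertex `v` of color `i` some color of `c` which is missing in the closed neighborhood of `v`;
the other vertices keep their colors. -/
def RecoloringStep (c' c : G.Coloring ℕ) : Prop :=
  ∃ i ∈ Set.range c, ∀ v, (c v ≠ i → c' v = c v) ∧
    (c v = i → c' v ∈ Set.range c ∧ c' v ∉ closedNeighborColors c v)

/-- A proper coloring is acyclic if any two color classes induce a forest. -/
def IsAcyclicColoring (c : G.Coloring ℕ) : Prop :=
  ∀ i j : ℕ, (G.induce {v | c v = i ∨ c v = j}).IsAcyclic

/-- The recoloring steps between members of a set `S` of colorings. -/
def StepIn (S : Set (G.Coloring ℕ)) (c' c : G.Coloring ℕ) : Prop :=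
  c' ∈ S ∧ c ∈ S ∧ RecoloringStep c' c

/-- The transitive closure of the recoloring steps inside `S`. -/
def PrecIn (S : Set (G.Coloring ℕ)) : G.Coloring ℕ → G.Coloring ℕ → Prop :=
  Relation.TransGen (StepIn S)

/-- `c` is a minimal element of `S` for the order `PrecIn S`. -/
def IsMinimalIn (S : Set (G.Coloring ℕ)) (c : G.Coloring ℕ) : Prop :=
  c ∈ S ∧ ∀ c' ∈ S, ¬ PrecIn S c' c

/-- The set `F(G)` of all proper colorings. -/
def allColorings (G : SimpleGraph V) : Set (G.Coloring ℕ) := Set.univ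

/-- The set `AF(G)` of all acyclic colorings. -/
def acyclicColorings (G : SimpleGraph V) : Set (G.Coloring ℕ) := {c | IsAcyclicColoring c}

/-- The b-chromatic number: the maximum number of colors of a minimal element of all colorings. -/
noncomputable def bChromaticNumber (G : SimpleGraph V) : ℕ :=
  sSup {k | ∃ c, IsMinimalIn (allColorings G) c ∧ numColors c = k}

/-- The acyclic b-chromatic number: the maximum number of colors of a minimal element of all
acyclic colorings. -/
noncomputable def acyclicBChromaticNumber (G : SimpleGraph V) : ℕ :=
  sSup {k | ∃ c, IsMinimalIn (acyclicColorings G) c ∧ numColors c = k}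

/-! On a finite graph both suprema are maxima. -/

theorem numColors_le_card [Fintype V] (c : G.Coloring ℕ) : numColors c ≤ Fintype.card V := by
  unfold numColors
  rw [← Set.image_univ]
  refine (Set.ncard_image_le Set.finite_univ).trans ?_
  rw [Set.ncard_univ, Nat.card_eq_fintype_card]

theorem numColors_lt_of_step [Finite V] {c' c : G.Coloring ℕ} (h : RecoloringStep c' c) :
    numColors c' < numColors c := by
  obtain ⟨i, hi, h⟩ := h
  refine Set.ncard_lt_ncard ?_ (Set.finite_range c)
  refine (Set.ssubset_iff_of_subset ?_).2 ⟨i, hi, ?_⟩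
  · rintro _ ⟨v, rfl⟩
    by_cases hv : c v = i
    · exact ((h v).2 hv).1
    · exact ⟨v, ((h v).1 hv).symm⟩
  · rintro ⟨v, hv'⟩
    by_cases hv : c v = i
    · exact ((h v).2 hv).2 ⟨v, Or.inl rfl, hv.trans hv'.symm⟩
    · exact hv (((h v).1 hv).symm.trans hv')

theorem exists_isMinimalIn [Finite V] {S : Set (G.Coloring ℕ)} (hS : S.Nonempty) :
    ∃ c, IsMinimalIn S c := by
  obtain ⟨c, hc, hmin⟩ := (measure (numColors (G := G))).wf.has_min S hS
  refine ⟨c, hc, fun c' _ hp => ?_⟩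
  obtain ⟨b, _, hb⟩ := Relation.TransGen.tail'_iff.1 hp
  exact hmin b hb.1 (numColors_lt_of_step hb.2.2)

theorem isGreatest_sSup [Fintype V] {S : Set (G.Coloring ℕ)} (hS : S.Nonempty) :
    IsGreatest {k | ∃ c, IsMinimalIn S c ∧ numColors c = k}
      (sSup {k | ∃ c, IsMinimalIn S c ∧ numColors c = k}) := by
  obtain ⟨c, hc⟩ := exists_isMinimalIn hS
  have hb : BddAbove {k | ∃ c, IsMinimalIn S c ∧ numColors c = k} :=
    ⟨Fintype.card V, by rintro _ ⟨c, _, rfl⟩; exact numColors_le_card c⟩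
  exact ⟨Nat.sSup_mem ⟨_, c, hc, rfl⟩ hb, fun _ hk => le_csSup hb hk⟩

theorem acyclicColorings_nonempty [Fintype V] (G : SimpleGraph V) :
    (acyclicColorings G).Nonempty := by
  let e := Fintype.equivFin V
  have inj : Function.Injective (fun v => (e v : ℕ)) := fun a b h => e.injective (Fin.ext h)
  refine ⟨SimpleGraph.Coloring.mk (fun v => (e v : ℕ)) (fun {v w} h he => h.ne (inj he)), ?_⟩
  intro i j v p hp
  have h3 := hp.three_le_length
  have hnd := hp.support_nodup
  have hlen : p.support.tail.length = p.length := by simp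
  have hsub : (p.support.tail.map (fun w => ((e w.1 : ℕ)))).toFinset ⊆ {i, j} := by
    intro a ha
    simp only [List.mem_toFinset, List.mem_map] at ha
    obtain ⟨w, _, rfl⟩ := ha
    have hw : (e w.1 : ℕ) = i ∨ (e w.1 : ℕ) = j := w.2
    simpa using hw
  have hc := Finset.card_le_card hsub
  rw [List.toFinset_card_of_nodup (hnd.map (fun a b h => Subtype.ext (inj h))),
    List.length_map, hlen] at hc
  have := Finset.card_le_two (a := i) (b := j)
  omega

theorem isGreatest_bChromaticNumber [Fintype V] (G : SimpleGraph V) :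
    IsGreatest {k | ∃ c, IsMinimalIn (allColorings G) c ∧ numColors c = k}
      (bChromaticNumber G) :=
  isGreatest_sSup ((acyclicColorings_nonempty G).mono (Set.subset_univ _))

theorem isGreatest_acyclicBChromaticNumber [Fintype V] (G : SimpleGraph V) :
    IsGreatest {k | ∃ c, IsMinimalIn (acyclicColorings G) c ∧ numColors c = k}
      (acyclicBChromaticNumber G) :=
  isGreatest_sSup (acyclicColorings_nonempty G)

end AcyclicBColoring

/-!
A color of a proper coloring can be eliminated as soon as each of its vertices misses some other
color in its closed neighborhood, so a minimal coloring has at most `Δ + 1` colors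
(`bChromaticNumber_le`). For acyclic colorings a color may also be forbidden at a vertex because it
would close a two-colored cycle, and this is what makes larger values possible.

The graph `gadgetGraph n` consists of `2n + 4` disjoint copies of a gadget: a center adjacent to two
hubs and `n + 1` leaves, and `n + 1` further vertices, the mids, adjacent to both hubs. The center
has the largest degree, `n + 3`.

* Suppose that in one copy the hubs share a color, and center, hubs, mids and leaves otherwise have
  pairwise distinct colors, `2n + 4` in all. The center cannot take the color of a hub or a leaf, and
  the color of a mid would close a two-colored 4-cycle with this mid and the hubs. So the color of
  the center cannot be eliminated. Cyclic shifts of the colors make every color that of the center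
  of some copy (`isMinimalIn_shiftColoring`).
* If an acyclic coloring has more than `2n + 4` colors, then some color `i` is on no center. All
  cycles of a copy lie in its core (center, hubs, mids), which has `n + 4` vertices, so there is a
  color other than `i` that is absent from the core. Recoloring the vertices of color `i` in
  the copy with it only renames a color of the core, which preserves acyclicity
  (`isAcyclicColoring_of_rename`). Hence the coloring is not minimal (`numColors_le_of_isMinimalIn`).

Acyclicity is handled through `isAcyclicColoring_iff`: there is no nonempty set of vertices in two
colors in which every vertex has two neighbors.
-/

namespace AcyclicBColoring

open SimpleGraph hiding center

/-! ### Two-colored cycles and sets of minimum degree two -/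

section Cycles

variable {W : Type*} {H : SimpleGraph W}

/-- A path in a forest without vertices of degree at most one extends beyond its start: a neighbor
of the start other than the second vertex is not on the path. -/
theorem exists_isPath_length_of_two_neighbors [Nonempty W] (hH : H.IsAcyclic)
    (h : ∀ x, ∃ y z, y ≠ z ∧ H.Adj x y ∧ H.Adj x z) (n : ℕ) :
    ∃ (u v : W) (p : H.Walk u v), p.IsPath ∧ p.length = n := by
  induction n with
  | zero =>
    obtain ⟨x⟩ := ‹Nonempty W›
    exact ⟨x, x, .nil, .nil, rfl⟩
  | succ n ih =>
    obtain ⟨u, v, p, hp, rfl⟩ := ih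
    obtain ⟨y, hy, hne⟩ : ∃ y, H.Adj u y ∧ y ≠ p.snd := by
      obtain ⟨y, z, hyz, hy, hz⟩ := h u
      by_cases hs : y = p.snd
      · exact ⟨z, hz, fun hz' => hyz (hs.trans hz'.symm)⟩
      · exact ⟨y, hy, hs⟩
    refine ⟨y, v, .cons hy.symm p, ?_, rfl⟩
    exact hp.cons fun hmem => hne (hH.eq_snd_of_adj_start hp hy hmem)

theorem not_isAcyclic_of_two_neighbors [Finite W] [Nonempty W]
    (h : ∀ x, ∃ y z, y ≠ z ∧ H.Adj x y ∧ H.Adj x z) : ¬ H.IsAcyclic := by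
  intro hH
  cases nonempty_fintype W
  obtain ⟨u, v, p, hp, hlen⟩ := exists_isPath_length_of_two_neighbors hH h (Fintype.card W)
  exact hp.length_lt.ne hlen

/-- A set of vertices in which every vertex has at least two neighbors. A finite nonempty such
set carries a cycle, and the vertices of a cycle form such a set. -/
def IsTwoCore (H : SimpleGraph W) (S : Set W) : Prop :=
  ∀ x ∈ S, ∃ y ∈ S, ∃ z ∈ S, y ≠ z ∧ H.Adj x y ∧ H.Adj x z

theorem isAcyclicColoring_iff [Finite W] {c : H.Coloring ℕ} :
    IsAcyclicColoring c ↔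
      ∀ (i j : ℕ) (S : Set W), (∀ x ∈ S, c x = i ∨ c x = j) → IsTwoCore H S → S = ∅ := by
  constructor
  · intro hc i j S hS hcore
    by_contra hne
    obtain ⟨x, hx⟩ := Set.nonempty_iff_ne_empty.2 hne
    have : Nonempty S := ⟨⟨x, hx⟩⟩
    refine not_isAcyclic_of_two_neighbors (H := H.induce S) ?_
      ((hc i j).comap (SimpleGraph.induceHomOfLE H hS).toHom (Set.inclusion_injective hS))
    rintro ⟨x, hx⟩
    obtain ⟨y, hy, z, hz, hyz, hxy, hxz⟩ := hcore x hx
    exact ⟨⟨y, hy⟩, ⟨z, hz⟩, fun h => hyz (congrArg Subtype.val h), hxy, hxz⟩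
  · intro h i j v p hp
    have hempty := h i j (Subtype.val '' {x | x ∈ p.support}) ?_ ?_
    · exact Set.notMem_empty v.1 (hempty ▸ ⟨v, p.start_mem_support, rfl⟩)
    · rintro _ ⟨x, -, rfl⟩
      exact x.2
    · rintro _ ⟨x, hx, rfl⟩
      obtain ⟨y, z, hyz, hN⟩ := Set.ncard_eq_two.1 (hp.ncard_neighborSet_toSubgraph_eq_two hx)
      have hy : p.toSubgraph.Adj x y := by
        rw [← Subgraph.mem_neighborSet, hN]; simp
      have hz : p.toSubgraph.Adj x z := by
        rw [← Subgraph.mem_neighborSet, hN]; simp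
      exact ⟨y, ⟨y, (p.mem_verts_toSubgraph).1 hy.snd_mem, rfl⟩,
        z, ⟨z, (p.mem_verts_toSubgraph).1 hz.snd_mem, rfl⟩,
        fun h => hyz (Subtype.ext h), hy.adj_sub, hz.adj_sub⟩

end Cycles

/-! ### Recoloring steps and the b-chromatic number -/

section Recoloring

variable {W : Type*} {H : SimpleGraph W}

/-- The recoloring of color `i` prescribed by `f` is proper: the vertices of color `i` are pairwise
non-adjacent, so the neighbors of a recolored vertex keep their colors. -/
theorem exists_recoloring (c : H.Coloring ℕ) (i : ℕ) (f : W → ℕ)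
    (hf : ∀ v, c v = i → f v ∉ closedNeighborColors c v) :
    ∃ c' : H.Coloring ℕ, (∀ v, c v = i → c' v = f v) ∧ ∀ v, c v ≠ i → c' v = c v := by
  refine ⟨Coloring.mk (fun v => if c v = i then f v else c v) ?_,
    fun v hv => if_pos hv, fun v hv => if_neg hv⟩
  intro v w hvw
  by_cases hv : c v = i
  · have hw : c w ≠ i := fun h => c.valid hvw (hv.trans h.symm)
    simp only [hv, hw, if_true, if_false]
    exact fun h => hf v hv ⟨w, Or.inr hvw, h.symm⟩
  · by_cases hw : c w = i
    · simp only [hv, hw, if_true, if_false]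
      exact fun h => hf w hw ⟨v, Or.inr hvw.symm, h⟩
    · simp only [hv, hw, if_false]
      exact c.valid hvw

theorem isMinimalIn_iff_forall_step {S : Set (H.Coloring ℕ)} {c : H.Coloring ℕ} :
    IsMinimalIn S c ↔ c ∈ S ∧ ∀ c' ∈ S, ¬ RecoloringStep c' c := by
  refine and_congr_right fun hc => ⟨fun h c' hc' hs => h c' hc' (.single ⟨hc', hc, hs⟩), ?_⟩
  intro h c' _ hp
  obtain ⟨b, _, hb⟩ := Relation.TransGen.tail'_iff.1 hp
  exact h b hb.1 hb.2.2

theorem ncard_closedNeighborColors_le [Fintype W] [DecidableRel H.Adj] (c : H.Coloring ℕ) (v : W) :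
    (closedNeighborColors c v).ncard ≤ H.maxDegree + 1 := by
  classical
  have hsub : closedNeighborColors c v ⊆ ((insert v (H.neighborFinset v)).image c : Finset ℕ) := by
    rintro _ ⟨w, hw, rfl⟩
    simp only [Finset.coe_image]
    exact ⟨w, by simpa using hw, rfl⟩
  calc (closedNeighborColors c v).ncard
      ≤ ((insert v (H.neighborFinset v)).image c).card := by
        rw [← Set.ncard_coe_finset]
        exact Set.ncard_le_ncard hsub (Finset.finite_toSet _)
    _ ≤ (H.neighborFinset v).card + 1 := Finset.card_image_le.trans (Finset.card_insert_le _ _)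
    _ ≤ H.maxDegree + 1 := by
        rw [card_neighborFinset_eq_degree]
        exact Nat.succ_le_succ (H.degree_le_maxDegree v)

/-- If there are more than `Δ + 1` colors, every vertex misses one of them in its closed
neighborhood, so any color can be eliminated. -/
theorem bChromaticNumber_le [Fintype W] (H : SimpleGraph W) [DecidableRel H.Adj] :
    bChromaticNumber H ≤ H.maxDegree + 1 := by
  obtain ⟨c, hc, hk⟩ := (isGreatest_bChromaticNumber H).1
  rw [← hk]
  by_contra! hlt
  have hf : ∀ v, ∃ a ∈ Set.range c, a ∉ closedNeighborColors c v := fun v =>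
    Set.exists_mem_notMem_of_ncard_lt_ncard
      ((ncard_closedNeighborColors_le c v).trans_lt hlt)
      ((Set.finite_range c).subset (by rintro _ ⟨w, -, rfl⟩; exact ⟨w, rfl⟩))
  choose f hf₁ hf₂ using hf
  obtain ⟨i, hi⟩ : (Set.range c).Nonempty :=
    Set.nonempty_of_ncard_ne_zero (Nat.ne_of_gt (Nat.zero_lt_of_lt hlt))
  obtain ⟨c', h₁, h₂⟩ := exists_recoloring c i f fun v _ => hf₂ v
  refine (isMinimalIn_iff_forall_step.1 hc).2 c' trivial
    ⟨i, hi, fun v => ⟨h₂ v, fun hv => ?_⟩⟩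
  rw [h₁ v hv]
  exact ⟨hf₁ v, hf₂ v⟩

end Recoloring

/-! ### The graphs -/

/-- The vertices of one gadget: a center, two hubs, and `n + 1` mids and `n + 1` leaves. -/
inductive Gadget (n : ℕ) : Type
  | center : Gadget n
  | hub (b : Bool) : Gadget n
  | mid (t : Fin (n + 1)) : Gadget n
  | leaf (t : Fin (n + 1)) : Gadget n
  deriving DecidableEq, Fintype

namespace Gadget

variable {n : ℕ}

/-- The center is joined to the hubs and the leaves, the hubs are joined to all mids. -/
def Adj : Gadget n → Gadget n → Prop
  | center, hub _ => True
  | hub _, center => True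
  | center, leaf _ => True
  | leaf _, center => True
  | hub _, mid _ => True
  | mid _, hub _ => True
  | _, _ => False

/-- The vertices of the gadget that are not leaves; all cycles lie there. -/
def IsCore : Gadget n → Prop
  | leaf _ => False
  | _ => True

end Gadget

open Gadget

/-- `2n + 4` disjoint copies of the gadget. -/
def gadgetGraph (n : ℕ) : SimpleGraph (Fin (2 * n + 4) × Gadget n) where
  Adj x y := x.1 = y.1 ∧ x.2.Adj y.2
  symm := ⟨by
    rintro ⟨m, p⟩ ⟨m', q⟩ ⟨h, hpq⟩
    refine ⟨h.symm, ?_⟩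
    cases p <;> cases q <;> exact hpq⟩
  loopless := ⟨by
    rintro ⟨m, p⟩ ⟨-, h⟩
    cases p <;> exact h⟩

variable {n : ℕ}

/-- A leaf has only one neighbor, so no cycle passes through it. -/
theorem core_of_isTwoCore {S : Set (Fin (2 * n + 4) × Gadget n)}
    (hS : IsTwoCore (gadgetGraph n) S) {x} (hx : x ∈ S) : x.2.IsCore := by
  obtain ⟨m, p⟩ := x
  cases p with
  | leaf t =>
    obtain ⟨⟨_, y⟩, -, ⟨_, z⟩, -, hyz, ⟨rfl, hy⟩, ⟨rfl, hz⟩⟩ := hS _ hx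
    cases y <;> cases z <;> first | exact hy.elim | exact hz.elim | exact (hyz rfl).elim
  | _ => trivial

/-- The hubs are the only neighbors of a mid, so a cycle through a mid uses both. -/
theorem hub_mem_of_isTwoCore {S : Set (Fin (2 * n + 4) × Gadget n)}
    (hS : IsTwoCore (gadgetGraph n) S) {m t} (hx : (m, mid t) ∈ S) (b : Bool) :
    (m, hub b) ∈ S := by
  obtain ⟨⟨_, y⟩, hyS, ⟨_, z⟩, hzS, hyz, ⟨rfl, hy⟩, ⟨rfl, hz⟩⟩ := hS _ hx
  cases y <;> cases z <;> first | exact hy.elim | exact hz.elim | skip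
  rename_i b₁ b₂
  have hb : b₁ ≠ b₂ := fun h => hyz (by rw [h])
  obtain h | h : b = b₁ ∨ b = b₂ := by
    cases b <;> cases b₁ <;> cases b₂ <;> simp_all
  · exact h ▸ hyS
  · exact h ▸ hzS

/-! ### The maximum degree -/

theorem degree_le_card_of_neighbors {W ι : Type*} [Fintype W] [Fintype ι] {H : SimpleGraph W}
    [DecidableRel H.Adj] {x : W} (f : ι → W) (hf : ∀ y, H.Adj x y → ∃ s, f s = y) :
    H.degree x ≤ Fintype.card ι := by
  classical
  rw [← card_neighborFinset_eq_degree]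
  refine (Finset.card_le_card (t := Finset.univ.image f) fun y hy => ?_).trans
    Finset.card_image_le
  simpa using hf y ((mem_neighborFinset _ _ _).1 hy)

theorem degree_gadgetGraph_le [DecidableRel (gadgetGraph n).Adj]
    (x : Fin (2 * n + 4) × Gadget n) : (gadgetGraph n).degree x ≤ n + 3 := by
  obtain ⟨m, p⟩ := x
  cases p with
  | center =>
    refine (degree_le_card_of_neighbors
      (fun s : Bool ⊕ Fin (n + 1) => (m, s.elim hub leaf)) ?_).trans (by simp; omega)
    rintro ⟨_, _ | b | t | t⟩ ⟨rfl, h⟩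
    · exact h.elim
    · exact ⟨.inl b, rfl⟩
    · exact h.elim
    · exact ⟨.inr t, rfl⟩
  | hub b =>
    refine (degree_le_card_of_neighbors
      (fun s : Option (Fin (n + 1)) => (m, s.elim center mid)) ?_).trans (by simp)
    rintro ⟨_, _ | b | t | t⟩ ⟨rfl, h⟩
    · exact ⟨none, rfl⟩
    · exact h.elim
    · exact ⟨some t, rfl⟩
    · exact h.elim
  | mid t =>
    refine (degree_le_card_of_neighbors (fun b : Bool => (m, hub b)) ?_).trans (by simp)
    rintro ⟨_, _ | b | t | t⟩ ⟨rfl, h⟩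
    · exact h.elim
    · exact ⟨b, rfl⟩
    · exact h.elim
    · exact h.elim
  | leaf t =>
    refine (degree_le_card_of_neighbors (fun _ : Unit => (m, center)) ?_).trans (by simp)
    rintro ⟨_, _ | b | t | t⟩ ⟨rfl, h⟩
    · exact ⟨(), rfl⟩
    · exact h.elim
    · exact h.elim
    · exact h.elim

theorem maxDegree_gadgetGraph (n : ℕ) [DecidableRel (gadgetGraph n).Adj] :
    (gadgetGraph n).maxDegree = n + 3 := by
  refine le_antisymm (maxDegree_le_of_forall_degree_le _ _ degree_gadgetGraph_le) ?_
  refine le_trans ?_ (degree_le_maxDegree _ ((0, center) : Fin (2 * n + 4) × Gadget n))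
  let f : Bool ⊕ Fin (n + 1) → Fin (2 * n + 4) × Gadget n := fun s => (0, s.elim hub leaf)
  have hinj : Function.Injective f := by
    rintro (a | a) (b | b) h <;> simp_all [f]
  have hsub : Finset.univ.map ⟨f, hinj⟩ ⊆ (gadgetGraph n).neighborFinset (0, center) := by
    intro y hy
    obtain ⟨s, -, rfl⟩ := Finset.mem_map.1 hy
    rw [mem_neighborFinset]
    cases s <;> exact ⟨rfl, trivial⟩
  have h := Finset.card_le_card hsub
  rw [Finset.card_map, card_neighborFinset_eq_degree] at h
  refine le_trans (le_of_eq ?_) h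
  simp
  omega

/-! ### The upper bound for the acyclic b-chromatic number -/

theorem ncard_image_core_le (c : (gadgetGraph n).Coloring ℕ) (m : Fin (2 * n + 4)) :
    {a | ∃ p : Gadget n, p.IsCore ∧ c (m, p) = a}.ncard ≤ n + 4 := by
  let f : Option (Bool ⊕ Fin (n + 1)) → ℕ := fun s => c (m, s.elim center (Sum.elim hub mid))
  have hsub : {a | ∃ p : Gadget n, p.IsCore ∧ c (m, p) = a} ⊆ f '' Set.univ := by
    rintro _ ⟨_ | b | t | t, hp, rfl⟩
    · exact ⟨none, trivial, rfl⟩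
    · exact ⟨some (.inl b), trivial, rfl⟩
    · exact ⟨some (.inr t), trivial, rfl⟩
    · exact hp.elim
  refine (Set.ncard_le_ncard hsub (Set.toFinite _)).trans
    ((Set.ncard_image_le Set.finite_univ).trans ?_)
  rw [Set.ncard_univ, Nat.card_eq_fintype_card]
  simp
  omega

theorem core_of_adj {p q : Gadget n} (h : p.Adj q) (hp : p ≠ center) : q.IsCore := by
  cases p <;> cases q <;> trivial

/-- Giving a color `i` that no center has, in each copy `m`, the new color `a m` absent from the
core of that copy, is on each core a mere renaming of colors. So it keeps the coloring acyclic. -/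
theorem isAcyclicColoring_of_rename {c c' : (gadgetGraph n).Coloring ℕ} {i : ℕ}
    {a : Fin (2 * n + 4) → ℕ} (hc : IsAcyclicColoring c)
    (ha : ∀ m p, Gadget.IsCore p → c (m, p) ≠ a m)
    (h₁ : ∀ x, c x = i → c' x = a x.1) (h₂ : ∀ x, c x ≠ i → c' x = c x) :
    IsAcyclicColoring c' := by
  rw [isAcyclicColoring_iff] at hc ⊢
  intro p q S hS hcore
  by_contra hne
  obtain ⟨⟨m, g⟩, hg⟩ := Set.nonempty_iff_ne_empty.2 hne
  -- On the core of copy `m`, `r` turns the new colors back into the old ones.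
  let r : ℕ → ℕ := fun b => if b = a m then i else b
  have hr : ∀ y ∈ S, y.1 = m → c y = r (c' y) := by
    rintro ⟨m', y⟩ hy rfl
    by_cases hi : c (m', y) = i
    · simp [r, h₁ _ hi, hi]
    · simp [r, h₂ _ hi, ha _ _ (core_of_isTwoCore hcore hy)]
  have hempty := hc (r p) (r q) {y | y ∈ S ∧ y.1 = m} ?_ ?_
  · exact Set.notMem_empty (m, g) (hempty ▸ ⟨hg, rfl⟩)
  · rintro y ⟨hy, hm⟩
    rw [hr y hy hm]
    exact (hS y hy).imp (congrArg r) (congrArg r)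
  · rintro x ⟨hx, hm⟩
    obtain ⟨y, hy, z, hz, hyz, hxy, hxz⟩ := hcore x hx
    exact ⟨y, ⟨hy, hxy.1.symm.trans hm⟩, z, ⟨hz, hxz.1.symm.trans hm⟩, hyz, hxy, hxz⟩

/-- With more colors than centers some color misses all centers, and it can be eliminated. -/
theorem numColors_le_of_isMinimalIn (hn : 1 ≤ n) {c : (gadgetGraph n).Coloring ℕ}
    (hc : IsMinimalIn (acyclicColorings (gadgetGraph n)) c) : numColors c ≤ 2 * n + 4 := by
  rw [isMinimalIn_iff_forall_step] at hc
  by_contra! hlt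
  obtain ⟨i, hi, hcenter⟩ : ∃ i ∈ Set.range c, i ∉ (fun m => c (m, center)) '' Set.univ := by
    refine Set.exists_mem_notMem_of_ncard_lt_ncard (lt_of_le_of_lt ?_ hlt) (Set.toFinite _)
    refine (Set.ncard_image_le Set.finite_univ).trans ?_
    rw [Set.ncard_univ, Nat.card_eq_fintype_card, Fintype.card_fin]
  have ha : ∀ m, ∃ a ∈ Set.range c, a ∉ insert i {a | ∃ p : Gadget n, p.IsCore ∧ c (m, p) = a} := by
    intro m
    have hfin : {a | ∃ p : Gadget n, p.IsCore ∧ c (m, p) = a}.Finite :=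
      (Set.finite_range c).subset (by rintro _ ⟨p, -, rfl⟩; exact ⟨_, rfl⟩)
    refine Set.exists_mem_notMem_of_ncard_lt_ncard ?_ (hfin.insert i)
    -- At most `n + 5` colors are excluded, and `n + 5 < 2n + 5` because `1 ≤ n`.
    have h₁ := Set.ncard_insert_le i {a | ∃ p : Gadget n, p.IsCore ∧ c (m, p) = a}
    have h₂ := ncard_image_core_le c m
    unfold numColors at hlt
    omega
  choose a ha hia using ha
  have hai : ∀ m, a m ≠ i := fun m h => hia m (Or.inl h)
  have hac : ∀ m p, Gadget.IsCore p → c (m, p) ≠ a m := fun m p hp h => hia m (Or.inr ⟨p, hp, h⟩)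
  have hf : ∀ x, c x = i → a x.1 ∉ closedNeighborColors c x := by
    rintro ⟨m, p⟩ hx ⟨⟨m', q⟩, h | ⟨h, hpq⟩, hw⟩
    · rw [h, hx] at hw
      exact hai m hw.symm
    · obtain rfl : m = m' := h
      refine hac m q (core_of_adj hpq ?_) hw
      rintro rfl
      exact hcenter ⟨m, trivial, hx⟩
  obtain ⟨c', h₁, h₂⟩ := exists_recoloring c i (fun x => a x.1) hf
  refine hc.2 c' (isAcyclicColoring_of_rename hc.1 hac h₁ h₂)
    ⟨i, hi, fun x => ⟨h₂ x, fun hx => ?_⟩⟩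
  rw [h₁ x hx]
  exact ⟨ha x.1, hf x hx⟩

/-! ### A minimal acyclic coloring with `2n + 4` colors -/

/-- The difference, modulo `2n + 4`, between the color of a vertex and the color of the center of
its copy, in the coloring `shiftColoring`. -/
def Gadget.offset : Gadget n → ℕ
  | center => 0
  | hub _ => 1
  | mid t => 2 + t
  | leaf t => n + 3 + t

theorem offset_lt (p : Gadget n) : p.offset < 2 * n + 4 := by
  cases p <;> simp only [Gadget.offset] <;> omega

theorem exists_offset_eq {o : ℕ} (ho : o < 2 * n + 4) : ∃ p : Gadget n, p.offset = o := by
  by_cases h₀ : o = 0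
  · exact ⟨center, h₀.symm⟩
  by_cases h₁ : o = 1
  · exact ⟨hub true, h₁.symm⟩
  by_cases h₂ : o < n + 3
  · exact ⟨mid ⟨o - 2, by omega⟩, by simp only [Gadget.offset]; omega⟩
  · exact ⟨leaf ⟨o - (n + 3), by omega⟩, by simp only [Gadget.offset]; omega⟩

theorem add_offset_mod_inj {m : ℕ} {p q : Gadget n} :
    (m + p.offset) % (2 * n + 4) = (m + q.offset) % (2 * n + 4) ↔ p.offset = q.offset := by
  refine ⟨fun h => ?_, fun h => by rw [h]⟩
  exact Nat.ModEq.eq_of_lt_of_lt (Nat.ModEq.add_left_cancel' m h) (offset_lt p) (offset_lt q)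

theorem offset_ne_of_adj {p q : Gadget n} (h : p.Adj q) : p.offset ≠ q.offset := by
  cases p <;> cases q <;> first | exact h.elim | (simp only [Gadget.offset]; omega)

/-- The coloring with `2n + 4` colors in which both hubs of a copy have the same color and apart
from that all colors occur exactly once in the copy. The center of copy `m` has color `m`. -/
def shiftColoring (n : ℕ) : (gadgetGraph n).Coloring ℕ :=
  Coloring.mk (fun x => (x.1 + x.2.offset) % (2 * n + 4)) (by
    rintro ⟨m, p⟩ ⟨m', q⟩ ⟨h, hpq⟩
    obtain rfl : m = m' := h
    exact fun h => offset_ne_of_adj hpq (add_offset_mod_inj.1 h))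

theorem shiftColoring_apply (m : Fin (2 * n + 4)) (p : Gadget n) :
    shiftColoring n (m, p) = (m + p.offset) % (2 * n + 4) := rfl

theorem shiftColoring_eq_iff {m : Fin (2 * n + 4)} {p q : Gadget n} :
    shiftColoring n (m, p) = shiftColoring n (m, q) ↔ p.offset = q.offset :=
  add_offset_mod_inj

theorem shiftColoring_center (m : Fin (2 * n + 4)) : shiftColoring n (m, center) = m :=
  Nat.mod_eq_of_lt m.2

theorem range_shiftColoring (n : ℕ) : Set.range (shiftColoring n) = Set.Iio (2 * n + 4) := by
  ext a
  constructor
  · rintro ⟨x, rfl⟩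
    exact Nat.mod_lt _ (by omega)
  · exact fun ha => ⟨(⟨a, ha⟩, center), shiftColoring_center _⟩

theorem exists_shiftColoring_eq (m : Fin (2 * n + 4)) {a : ℕ} (ha : a < 2 * n + 4) :
    ∃ p, shiftColoring n (m, p) = a := by
  obtain ⟨p, hp⟩ := exists_offset_eq (n := n) (o := (a + (2 * n + 4 - m)) % (2 * n + 4))
    (Nat.mod_lt _ (by omega))
  refine ⟨p, ?_⟩
  have hm := m.2
  rw [shiftColoring_apply, hp, Nat.add_mod_mod,
    show (m : ℕ) + (a + (2 * n + 4 - m)) = a + (2 * n + 4) by omega, Nat.add_mod_right,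
    Nat.mod_eq_of_lt ha]

/-- A two-colored cycle would contain a mid, since no hub has two neighbors otherwise, hence both
hubs; but all neighbors of a hub have different colors. -/
theorem isAcyclicColoring_shiftColoring (n : ℕ) : IsAcyclicColoring (shiftColoring n) := by
  rw [isAcyclicColoring_iff]
  intro i j S hS hcore
  have hhub : ∀ m b, (m, hub b) ∉ S := by
    intro m b hb
    obtain ⟨⟨_, y⟩, hy, ⟨_, z⟩, hz, hyz, ⟨rfl, hby⟩, ⟨rfl, hbz⟩⟩ := hcore _ hb
    -- Both neighbors have the one of the two colors `i`, `j` that the hub does not have.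
    have hcol : shiftColoring n (m, y) = shiftColoring n (m, z) := by
      have hy' : shiftColoring n (m, hub b) ≠ shiftColoring n (m, y) :=
        (shiftColoring n).valid ⟨rfl, hby⟩
      have hz' : shiftColoring n (m, hub b) ≠ shiftColoring n (m, z) :=
        (shiftColoring n).valid ⟨rfl, hbz⟩
      have h₁ := hS _ hb
      have h₂ := hS _ hy
      have h₃ := hS _ hz
      simp only at h₂ h₃
      omega
    rw [shiftColoring_eq_iff] at hcol
    cases y <;> cases z <;> first | exact hby.elim | exact hbz.elim | exact hyz rfl | skip
    all_goals simp only [Gadget.offset] at hcol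
    · omega
    · omega
    · refine hyz ?_
      congr 2
      exact Fin.ext (Nat.add_left_cancel hcol)
  have hmid : ∀ m t, (m, mid t) ∉ S := fun m t h =>
    hhub m true (hub_mem_of_isTwoCore hcore h true)
  refine Set.eq_empty_of_forall_notMem ?_
  rintro ⟨m, _ | b | t | t⟩ hx
  · obtain ⟨⟨_, y⟩, hy, -, -, -, ⟨rfl, h⟩, -⟩ := hcore _ hx
    cases y with
    | center => exact h
    | hub b => exact hhub _ _ hy
    | mid t => exact h
    | leaf t => exact core_of_isTwoCore hcore hy
  · exact hhub _ _ hx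
  · exact hmid _ _ hx
  · exact core_of_isTwoCore hcore hx

/-- The vertices of the 4-cycle through the center, a mid and the two hubs. -/
theorem isTwoCore_center_hubs_mid (m : Fin (2 * n + 4)) (t : Fin (n + 1)) :
    IsTwoCore (gadgetGraph n) {x | ∃ p, (p = center ∨ (∃ b, p = hub b) ∨ p = mid t) ∧
      x = (m, p)} := by
  have hh : ∀ b, ((m, hub b) : Fin (2 * n + 4) × Gadget n) ∈ {x : Fin (2 * n + 4) × Gadget n |
      ∃ p, (p = center ∨ (∃ b, p = hub b) ∨ p = mid t) ∧ x = (m, p)} :=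
    fun b => ⟨_, Or.inr (Or.inl ⟨b, rfl⟩), rfl⟩
  rintro _ ⟨_, rfl | ⟨b, rfl⟩ | rfl, rfl⟩
  · exact ⟨_, hh true, _, hh false, by simp, ⟨rfl, trivial⟩, ⟨rfl, trivial⟩⟩
  · exact ⟨(m, center), ⟨_, Or.inl rfl, rfl⟩, (m, mid t), ⟨_, Or.inr (Or.inr rfl), rfl⟩, by simp,
      ⟨rfl, trivial⟩, ⟨rfl, trivial⟩⟩
  · exact ⟨_, hh true, _, hh false, by simp, ⟨rfl, trivial⟩, ⟨rfl, trivial⟩⟩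

/-- Eliminating color `i` fails at the center of copy `i`: the colors that do not occur in its
neighborhood are those of the mids, and the color of a mid closes a two-colored 4-cycle through
this mid and the hubs. -/
theorem isMinimalIn_shiftColoring (n : ℕ) :
    IsMinimalIn (acyclicColorings (gadgetGraph n)) (shiftColoring n) := by
  refine isMinimalIn_iff_forall_step.2 ⟨isAcyclicColoring_shiftColoring n, ?_⟩
  rintro c' hc' ⟨i, hi, h⟩
  rw [range_shiftColoring] at hi h
  let m : Fin (2 * n + 4) := ⟨i, hi⟩
  have hm : shiftColoring n (m, center) = i := shiftColoring_center m
  obtain ⟨hlt, hnbr⟩ := (h (m, center)).2 hm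
  obtain ⟨p, hp⟩ := exists_shiftColoring_eq m hlt
  have hkeep : ∀ q : Gadget n, q.offset ≠ 0 → c' (m, q) = shiftColoring n (m, q) := fun q hq =>
    (h (m, q)).1 fun hq' => hq (shiftColoring_eq_iff.1 (hq'.trans hm.symm))
  rcases p with _ | b | t | t
  · exact hnbr ⟨_, Or.inl rfl, hp⟩
  · exact hnbr ⟨(m, hub b), Or.inr ⟨rfl, trivial⟩, hp⟩
  · refine Set.notMem_empty (m, mid t) ?_
    rw [← isAcyclicColoring_iff.1 hc' (c' (m, mid t)) (c' (m, hub true)) _ ?_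
      (isTwoCore_center_hubs_mid m t)]
    · exact ⟨_, Or.inr (Or.inr rfl), rfl⟩
    · rintro _ ⟨_, rfl | ⟨b, rfl⟩ | rfl, rfl⟩
      · left
        rw [← hp, hkeep _ (by simp [Gadget.offset])]
      · right
        rw [hkeep _ (by simp [Gadget.offset]), hkeep _ (by simp [Gadget.offset])]
        rfl
      · exact Or.inl rfl
  · exact hnbr ⟨(m, leaf t), Or.inr ⟨rfl, trivial⟩, hp⟩

theorem acyclicBChromaticNumber_gadgetGraph (hn : 1 ≤ n) :
    acyclicBChromaticNumber (gadgetGraph n) = 2 * n + 4 := by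
  have hgreatest := isGreatest_acyclicBChromaticNumber (gadgetGraph n)
  refine hgreatest.unique ⟨⟨shiftColoring n, isMinimalIn_shiftColoring n, ?_⟩, ?_⟩
  · rw [numColors, range_shiftColoring, ← Finset.coe_Iio, Set.ncard_coe_finset, Nat.card_Iio]
  · rintro _ ⟨c, hc, rfl⟩
    exact numColors_le_of_isMinimalIn hn hc

end AcyclicBColoring

theorem mainTheorem5 :
    (∃ (V : ℕ → Type) (_ : ∀ n, Fintype (V n)) (G : ∀ n, SimpleGraph (V n))
        (_ : ∀ n, DecidableRel (G n).Adj),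
      (∀ n : ℕ, 1 ≤ n →
        AcyclicBColoring.acyclicBChromaticNumber (G n) = 2 * n + 4 ∧
        (G n).maxDegree = n + 3 ∧
        (G n).maxDegree + 1 < AcyclicBColoring.acyclicBChromaticNumber (G n)) ∧
      Filter.Tendsto
        (fun n : ℕ => (AcyclicBColoring.acyclicBChromaticNumber (G n) : ℤ) - ((G n).maxDegree : ℤ))
        Filter.atTop Filter.atTop) ∧
    (∀ (W : Type*) [Fintype W] (H : SimpleGraph W) [DecidableRel H.Adj],
      AcyclicBColoring.bChromaticNumber H ≤ H.maxDegree + 1) := by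
  classical
  have key : ∀ n : ℕ, 1 ≤ n →
      AcyclicBColoring.acyclicBChromaticNumber (AcyclicBColoring.gadgetGraph n) = 2 * n + 4 :=
    fun n hn => AcyclicBColoring.acyclicBChromaticNumber_gadgetGraph hn
  refine ⟨⟨_, fun n => inferInstance, AcyclicBColoring.gadgetGraph,
    fun n => Classical.decRel _, fun n hn => ?_, ?_⟩, ?_⟩
  · rw [key n hn, AcyclicBColoring.maxDegree_gadgetGraph]
    exact ⟨rfl, rfl, by omega⟩
  · refine Filter.tendsto_atTop_mono' _ ?_ tendsto_natCast_atTop_atTop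
    filter_upwards [Filter.eventually_ge_atTop 1] with n hn
    rw [key n hn, AcyclicBColoring.maxDegree_gadgetGraph]
    push_cast
    omega
  · intro W _ H _
    exact AcyclicBColoring.bChromaticNumber_le H
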